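/- Let $\alpha\in[0,2)$, $\beta>0$ and $\mu\in\mathbb R$ satisfy one of the following, where $\mu(\alpha)=\frac{(1-\alpha)^2}{4}$: - (sub-critical potentials) $\beta<2-\alpha$; or $\alpha\neq 1$, $\beta=2-\alpha$ and $\mu<\mu(\alpha)$; - (critical potentials) $\alpha\ne 1$, $\beta=2-\alpha$ and $\mu=\mu(\alpha)$. On the real Hilbert space $L^2(0,1)$ consider the operator $$Au=(x^\alpha u_x)_x+\frac{\mu}{x^\beta}u ,$$ whose domain $D(A)$ consists of those $u\in L^2(0,1)\cap H^2_{loc}((0,1])$ with $Au\in L^2(0,1)$ such that - $x^{\alpha/2}u_x\in L^2(0,1)$ in the sub-critical case, and $x^\alpha u_x^2-\frac{\mu(\alpha)}{x^{2-\alpha}}u^2$ is integrable on $(0,1)$ in the critical case; - $u(1)=0$, together with $u(0)=0$ if $\alpha<1$, and $(x^\alpha u_x)(0)=0$ if $\alpha\ge 1$. Let $(e^{tA})_{t\ge0}$ be the strongly continuous semigroup on $L^2(0,1)$ generated by $A$. Let $\omega=(0,a)$ with $a\in(0,1)$, let $\mathbb 1_\omega^*:L^2(0,1)\to L^2(\omega)$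 be the restriction to $\omega$, and let $T>0$, $b>1$, $t_k=T\left(1-\frac1{b^k}\right)$ and $\tau_k=\frac{t_k+t_{k+1}}2$ for $k\ge 0$. Then for every $y_0\in L^2(0,1)$ and every integer $k\ge0$ the functional $$\mathcal J_k(v)=\frac12\left\|\mathbb 1_\omega^*\,e^{(t_{k+1}-\tau_k)A}v\right\|_{L^2(\omega)}^2+\left\langle y_0,e^{(t_{k+1}-t_k)A}v\right\rangle,\qquad v\in L^2(0,1),$$ is not coercive on $L^2(0,1)$; that is, it is not true that $\mathcal J_k(v)\to+\infty$ as $\|v\|\to\infty$. -/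

import Mathlib

open MeasureTheory Set Filter Topology

noncomputable section

namespace ImpulseControl

/-- Lebesgue measure on `(0,1)`. -/
abbrev vol01 : Measure ℝ := volume.restrict (Ioo (0 : ℝ) 1)

/-- The real Hilbert space `L²(0,1)`. -/
abbrev L2 : Type := Lp ℝ 2 vol01

/-- The critical constant `μ(α) = (1 - α)² / 4` of the Hardy-Poincaré inequality. -/
def muCrit (α : ℝ) : ℝ := (1 - α) ^ 2 / 4

/-- Sub-critical potentials. -/
def SubCritical (α β μ : ℝ) : Prop :=
  (0 ≤ α ∧ α < 2 ∧ 0 < β ∧ β < 2 - α) ∨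
    (0 ≤ α ∧ α < 2 ∧ α ≠ 1 ∧ β = 2 - α ∧ μ < muCrit α)

/-- Critical potentials. -/
def Critical (α β μ : ℝ) : Prop :=
  0 ≤ α ∧ α < 2 ∧ α ≠ 1 ∧ β = 2 - α ∧ μ = muCrit α

/-- `U ∈ H¹_loc((0,1])` with weak derivative `U'`, where `U` is the representative that is
continuous on `(0,1]`: the derivative is square integrable on `(ε,1)` for every `ε ∈ (0,1)`, and
`U` is the primitive of `U'` on `(0,1]` (the description of one-dimensional `H¹` functions by
locally absolutely continuous functions). The values of `U` outside `(0,1]` play no role. -/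
def IsLocH1 (U U' : ℝ → ℝ) : Prop :=
  (∀ ε : ℝ, 0 < ε → ε < 1 → MemLp U' 2 (volume.restrict (Ioo ε 1))) ∧
    ∀ x ∈ Ioc (0 : ℝ) 1, U x = U 1 - ∫ t in x..1, U' t

/-- The energy condition, for `U` with derivative `U'`, in the definition of the weighted space:
`x^{α/2} U' ∈ L²(0,1)` for sub-critical potentials (the space `H¹_α`), and
integrability of `x^α (U')² - μ(α) x^{-(2-α)} U²` for critical potentials
(the space `H^{1,μ(α)}_α`). -/
def FiniteEnergy (α β μ : ℝ) (U U' : ℝ → ℝ) : Prop :=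
  (SubCritical α β μ → MemLp (fun x => x ^ (α / 2) * U' x) 2 vol01) ∧
    (Critical α β μ →
      Integrable (fun x => x ^ α * U' x ^ 2 - muCrit α / x ^ (2 - α) * U x ^ 2) vol01)

/-- The boundary conditions: Dirichlet at `1`; at the degeneracy point `0`, Dirichlet in the
weakly degenerate case `α < 1` and vanishing flux `(x^α u_x)(0) = 0` in the strongly degenerate
case `1 ≤ α`. -/
def BoundaryConditions (α : ℝ) (U U' : ℝ → ℝ) : Prop :=
  U 1 = 0 ∧
    (α < 1 → Tendsto U (𝓝[>] 0) (𝓝 0)) ∧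
    (1 ≤ α → Tendsto (fun x => x ^ α * U' x) (𝓝[>] 0) (𝓝 0))

/-- The graph of the operator `A u = (x^α u_x)_x + (μ / x^β) u`: `OpGraph α β μ u f` says that
`u ∈ D(A)` and `A u = f`. Here `U` is the continuous representative of `u`, `U'` and `U''` are
its first two weak derivatives (so `u ∈ H²_loc((0,1])`), and `Q` is the weak derivative of
`x^α U'`. -/
def OpGraph (α β μ : ℝ) (u f : L2) : Prop :=
  ∃ U U' U'' Q : ℝ → ℝ,
    u =ᵐ[vol01] U ∧
    IsLocH1 U U' ∧ IsLocH1 U' U'' ∧ IsLocH1 (fun x => x ^ α * U' x) Q ∧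
    FiniteEnergy α β μ U U' ∧ BoundaryConditions α U U' ∧
    f =ᵐ[vol01] fun x => Q x + μ / x ^ β * U x

/-- Strongly continuous semigroups of bounded operators on `L²(0,1)`. Only the times `t ≥ 0`
matter. -/
structure IsC0Semigroup (S : ℝ → L2 →L[ℝ] L2) : Prop where
  zero : S 0 = ContinuousLinearMap.id ℝ L2
  add : ∀ s t : ℝ, 0 ≤ s → 0 ≤ t → S (s + t) = (S s).comp (S t)
  tendsto_zero : ∀ v : L2, Tendsto (fun t => S t v) (𝓝[>] 0) (𝓝 v)

/-- The graph of the infinitesimal generator of `S`: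
`u` is in its domain and is sent to `f`. -/
def GeneratorGraph (S : ℝ → L2 →L[ℝ] L2) (u f : L2) : Prop :=
  Tendsto (fun t : ℝ => t⁻¹ • (S t u - u)) (𝓝[>] 0) (𝓝 f)

/-- `S t = e^{tA}`: `S` is the strongly continuous semigroup whose infinitesimal generator is
exactly `A`, domain included. -/
def IsSemigroupOf (α β μ : ℝ) (S : ℝ → L2 →L[ℝ] L2) : Prop :=
  IsC0Semigroup S ∧ ∀ u f : L2, GeneratorGraph S u f ↔ OpGraph α β μ u f

/-- `t_k = T (1 - 1 / b^k)`. -/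
def tSeq (T b : ℝ) (k : ℕ) : ℝ := T * (1 - 1 / b ^ k)

/-- The impulse times `τ_k = (t_k + t_{k+1}) / 2`. -/
def tauSeq (T b : ℝ) (k : ℕ) : ℝ := (tSeq T b k + tSeq T b (k + 1)) / 2

/-- `𝟙_ω^* : L²(0,1) → L²(ω)`, the restriction to `ω`, the adjoint of the extension by zero. -/
def restrictTo (ω : Set ℝ) : L2 →L[ℝ] Lp ℝ 2 (vol01.restrict ω) :=
  LpToLpRestrictCLM ℝ ℝ ℝ vol01 2 ω

/-- The dual functional
`J_k(v) = ½ ‖𝟙_ω^* e^{(t_{k+1} - τ_k) A} v‖²_ω + ⟨y₀, e^{(t_{k+1} - t_k) A} v⟩`. -/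
def dualFunctional (S : ℝ → L2 →L[ℝ] L2) (ω : Set ℝ) (T b : ℝ) (y₀ : L2) (k : ℕ) (v : L2) : ℝ :=
  1 / 2 * ‖restrictTo ω (S (tSeq T b (k + 1) - tauSeq T b k) v)‖ ^ 2 +
    inner ℝ y₀ (S (tSeq T b (k + 1) - tSeq T b k) v)

/-- Coercivity: `J(v) → +∞` as `‖v‖ → ∞`. -/
def Coercive (J : L2 → ℝ) : Prop := Tendsto J (comap norm atTop) atTop

end ImpulseControl

end

namespace ImpulseControl

open Real

/-! ### Bounds and regularity of orbits of a strongly continuous semigroup. -/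

section Semigroup

variable {S : ℝ → L2 →L[ℝ] L2}

/-! Put `h = t_{k+1} - τ_k > 0`. Since `τ_k` is a midpoint, `t_{k+1} - t_k = 2h`, so both terms of
the functional see `v` only through `S h v`. If `S h` is not bounded below, there are `v` of
arbitrarily large norm with `‖S h v‖ ≤ 1`, and along them the functional stays below a fixed
constant.

That `S h` is not bounded below (`IsSemigroupOf.exists_norm_apply_le`) needs no spectral theory of
`A`. A WKB wave `sin (n θ + δ) φ`, with `φ` a bump supported away from `0` and `1`, lies in the
domain whatever happens at the singularity, and satisfies `A u = -n² u + O(n)` with `‖u‖` bounded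
below (`exists_quasimode`). Duhamel's formula (`norm_apply_le_of_quasimode`) then gives `‖S h u‖ ≤
e^{-n² h} ‖u‖ + O(1/n)`. -/

theorem IsC0Semigroup.exists_bound_near_zero (hS : IsC0Semigroup S) :
    ∃ δ > 0, ∃ M, ∀ t, 0 ≤ t → t ≤ δ → ‖S t‖ ≤ M := by
  by_contra! hcon
  -- Exceeding `‖S 0‖` forces `t n ≠ 0`, so that continuity along `𝓝[>] 0` applies to the sequence.
  have hex : ∀ n : ℕ, ∃ t : ℝ, 0 ≤ t ∧ t ≤ 1 / ((n : ℝ) + 1) ∧ max (n : ℝ) ‖S 0‖ < ‖S t‖ :=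
    fun n => hcon (1 / ((n : ℝ) + 1)) (by positivity) _
  choose t ht0 htn htS using hex
  have htpos : ∀ n, 0 < t n := fun n => by
    rcases (ht0 n).eq_or_lt with h | h
    · exact absurd (htS n) (by rw [← h]; exact not_lt.mpr (le_max_right _ _))
    · exact h
  have htlim : Tendsto t atTop (𝓝[>] 0) := by
    refine tendsto_nhdsWithin_iff.mpr ⟨?_, Eventually.of_forall htpos⟩
    exact squeeze_zero ht0 htn tendsto_one_div_add_atTop_nhds_zero_nat
  obtain ⟨C, hC⟩ := banach_steinhaus (g := fun n => S (t n)) fun v => by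
    obtain ⟨C, hC⟩ := (((hS.tendsto_zero v).comp htlim).norm).bddAbove_range
    exact ⟨C, fun n => hC ⟨n, rfl⟩⟩
  obtain ⟨n, hn⟩ := exists_nat_gt C
  exact absurd (hC n) (not_le.mpr (hn.trans ((le_max_left _ _).trans_lt (htS n))))

/-- The semigroup law propagates the bound near zero in steps of length `δ`. -/
theorem IsC0Semigroup.exists_bound (hS : IsC0Semigroup S) (h : ℝ) :
    ∃ M, 0 ≤ M ∧ ∀ t, 0 ≤ t → t ≤ h → ‖S t‖ ≤ M := by
  obtain ⟨δ, hδ, M, hM⟩ := hS.exists_bound_near_zero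
  have hM0 : 0 ≤ M := (norm_nonneg _).trans (hM 0 le_rfl hδ.le)
  have key : ∀ n : ℕ, ∃ K, 0 ≤ K ∧ ∀ t, 0 ≤ t → t ≤ n * δ → ‖S t‖ ≤ K := by
    intro n
    induction n with
    | zero => exact ⟨M, hM0, fun t h0 h1 => hM t h0 (h1.trans (by simpa using hδ.le))⟩
    | succ n ih =>
      obtain ⟨K, hK0, hK⟩ := ih
      refine ⟨max M (M * K), hM0.trans (le_max_left _ _), fun t h0 h1 => ?_⟩
      rcases le_total t δ with h2 | h2
      · exact (hM t h0 h2).trans (le_max_left _ _)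
      · have h3 : S t = (S δ).comp (S (t - δ)) := by
          rw [← hS.add δ (t - δ) hδ.le (by linarith)]
          congr 1
          ring
        rw [h3]
        refine ((S δ).opNorm_comp_le _).trans (le_trans ?_ (le_max_right _ _))
        refine mul_le_mul (hM δ hδ.le le_rfl) (hK _ (by linarith) ?_) (norm_nonneg _) hM0
        push_cast at h1
        linarith
  obtain ⟨n, hn⟩ := exists_nat_ge (h / δ)
  obtain ⟨K, hK0, hK⟩ := key n
  exact ⟨K, hK0, fun t h0 h1 => hK t h0 (h1.trans ((div_le_iff₀ hδ).mp hn))⟩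

theorem tendsto_sub_nhdsGT_zero (t : ℝ) : Tendsto (fun y => y - t) (𝓝[>] t) (𝓝[>] 0) := by
  refine tendsto_nhdsWithin_iff.mpr ⟨?_, ?_⟩
  · have : Tendsto (fun y : ℝ => y - t) (𝓝 t) (𝓝 (t - t)) := by
      exact tendsto_id.sub_const t
    rw [sub_self] at this
    exact this.mono_left nhdsWithin_le_nhds
  · filter_upwards [self_mem_nhdsWithin] with y hy
    exact mem_Ioi.mpr (sub_pos.mpr (mem_Ioi.mp hy))

theorem IsC0Semigroup.add_apply (hS : IsC0Semigroup S) {s t : ℝ} (hs : 0 ≤ s) (ht : 0 ≤ t)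
    (v : L2) : S (s + t) v = S s (S t v) := by
  rw [hS.add s t hs ht]
  rfl

/-- For `p ≤ q`, `S q v - S p v = S p (S (q - p) v - v)`; the uniform bound on `S p` turns right
continuity at `0` into two-sided continuity. -/
theorem IsC0Semigroup.continuousOn_orbit (hS : IsC0Semigroup S) (h : ℝ) (v : L2) :
    ContinuousOn (fun t => S t v) (Icc 0 h) := by
  obtain ⟨M, hM0, hM⟩ := hS.exists_bound h
  have hlim : Tendsto (fun r : ℝ => M * ‖S r v - v‖) (𝓝[≥] 0) (𝓝 0) := by
    have h1 : Tendsto (fun r : ℝ => S r v) (𝓝[≥] 0) (𝓝 v) := by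
      rw [← Ioi_insert, nhdsWithin_insert]
      refine Tendsto.sup ?_ (hS.tendsto_zero v)
      have : S 0 v = v := by rw [hS.zero]; rfl
      rw [tendsto_pure_left]
      intro s hs
      rw [this]
      exact mem_of_mem_nhds hs
    have h2 := ((h1.sub_const v).norm).const_mul M
    simpa using h2
  have habs : ∀ t : ℝ, Tendsto (fun s => |s - t|) (𝓝[Icc 0 h] t) (𝓝[≥] 0) := by
    intro t
    refine tendsto_nhdsWithin_iff.mpr ⟨?_, Eventually.of_forall fun s => mem_Ici.mpr (abs_nonneg _)⟩
    have : Continuous fun s : ℝ => |s - t| := by fun_prop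
    have h1 := this.tendsto t
    simp only [sub_self, abs_zero] at h1
    exact h1.mono_left nhdsWithin_le_nhds
  intro t ht
  refine tendsto_iff_norm_sub_tendsto_zero.mpr ?_
  refine squeeze_zero' (Eventually.of_forall fun s => norm_nonneg _) ?_ (hlim.comp (habs t))
  filter_upwards [self_mem_nhdsWithin] with s hs
  have key : ∀ p q : ℝ, 0 ≤ p → p ≤ q → q ≤ h →
      ‖S q v - S p v‖ ≤ M * ‖S (q - p) v - v‖ := by
    intro p q hp hpq hq
    have h1 : S q v = S p (S (q - p) v) := by
      rw [← hS.add_apply hp (by linarith)]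
      congr 2
      ring
    rw [h1, ← map_sub]
    exact (S p).le_of_opNorm_le (hM p hp (hpq.trans hq)) _
  simp only [Function.comp]
  rcases le_total t s with h1 | h1
  · rw [abs_of_nonneg (sub_nonneg.mpr h1)]
    exact key t s ht.1 h1 hs.2
  · rw [abs_of_nonpos (sub_nonpos.mpr h1), norm_sub_rev, neg_sub]
    exact key s t hs.1 h1 ht.2

theorem IsC0Semigroup.hasDerivWithinAt_orbit (hS : IsC0Semigroup S) {u f : L2}
    (huf : GeneratorGraph S u f) {t : ℝ} (ht : 0 ≤ t) :
    HasDerivWithinAt (fun s => S s u) (S t f) (Ici t) t := by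
  rw [← hasDerivWithinAt_Ioi_iff_Ici, hasDerivWithinAt_iff_tendsto_slope' (by simp)]
  have h1 := ((S t).continuous.tendsto f).comp (huf.comp (tendsto_sub_nhdsGT_zero t))
  refine h1.congr' ?_
  filter_upwards [self_mem_nhdsWithin] with y hy
  have h2 : S y u = S t (S (y - t) u) := by
    rw [← hS.add_apply ht (sub_nonneg.mpr (le_of_lt hy))]
    congr 2
    ring
  simp only [Function.comp, slope, vsub_eq_sub, map_smul, map_sub]
  rw [h2]

/-- Decay of the orbit of an approximate eigenvector `u` for the approximate eigenvalue `-l`. -/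
theorem IsC0Semigroup.norm_apply_le_of_quasimode (hS : IsC0Semigroup S) {u f : L2}
    (huf : GeneratorGraph S u f) {h l M K : ℝ} (hh : 0 ≤ h) (hl : 0 < l)
    (hM : ∀ t, 0 ≤ t → t ≤ h → ‖S t‖ ≤ M) (hK : ‖f + l • u‖ ≤ K) :
    ‖S h u‖ ≤ rexp (-(l * h)) * ‖u‖ + M * K / l := by
  have hM0 : 0 ≤ M := (norm_nonneg _).trans (hM 0 le_rfl hh)
  have hK0 : 0 ≤ K := (norm_nonneg _).trans hK
  have hexp : ∀ t : ℝ, HasDerivAt (fun s => rexp (l * s)) (l * rexp (l * t)) t := fun t => by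
    simpa [mul_comm] using ((hasDerivAt_id t).const_mul l).exp
  -- Duhamel as a mean value inequality: `e^{lt} S t u - u` vanishes at `0` and has right derivative
  -- `e^{lt} S t (f + l u)`, of norm at most `M K e^{lt}`.
  have hmain := image_norm_le_of_norm_deriv_right_le_deriv_boundary
    (f := fun t => rexp (l * t) • S t u - u)
    (f' := fun t => rexp (l * t) • S t f + (l * rexp (l * t)) • S t u)
    (a := 0) (b := h) (B := fun t => M * K / l * (rexp (l * t) - 1))
    (B' := fun t => M * K / l * (l * rexp (l * t))) ?_ ?_ ?_ ?_ ?_ (right_mem_Icc.mpr hh)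
  · have h1 : ‖rexp (l * h) • S h u‖ ≤ ‖u‖ + M * K / l * (rexp (l * h) - 1) := by
      have := norm_add_le (rexp (l * h) • S h u - u) u
      rw [sub_add_cancel] at this
      linarith
    rw [norm_smul, Real.norm_of_nonneg (exp_pos _).le] at h1
    have h2 : ‖S h u‖ = rexp (-(l * h)) * (rexp (l * h) * ‖S h u‖) := by
      rw [← mul_assoc, ← Real.exp_add]
      simp
    rw [h2]
    have h3 := mul_le_mul_of_nonneg_left h1 (exp_pos (-(l * h))).le
    refine h3.trans ?_
    have h4 : rexp (-(l * h)) * rexp (l * h) = 1 := by rw [← Real.exp_add]; simp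
    have h5 : 0 ≤ M * K / l := by positivity
    have h6 := exp_pos (-(l * h))
    calc rexp (-(l * h)) * (‖u‖ + M * K / l * (rexp (l * h) - 1))
        = rexp (-(l * h)) * ‖u‖ + M * K / l * (rexp (-(l * h)) * rexp (l * h))
          - M * K / l * rexp (-(l * h)) := by ring
      _ ≤ rexp (-(l * h)) * ‖u‖ + M * K / l := by
        rw [h4]
        have := mul_nonneg h5 h6.le
        linarith
  · have hc : Continuous fun t : ℝ => rexp (l * t) := by fun_prop
    exact (hc.continuousOn.smul (hS.continuousOn_orbit h u)).sub continuousOn_const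
  · intro t ht
    exact ((hexp t).hasDerivWithinAt.smul (hS.hasDerivWithinAt_orbit huf ht.1)).sub_const u
  · simp [hS.zero]
  · intro t
    exact ((hexp t).sub_const 1).const_mul _
  · intro t ht
    have h1 : rexp (l * t) • S t f + (l * rexp (l * t)) • S t u
        = rexp (l * t) • S t (f + l • u) := by
      rw [map_add, map_smul, smul_add, smul_smul, mul_comm l (rexp _)]
    rw [h1, norm_smul, Real.norm_of_nonneg (exp_pos _).le]
    have h2 : ‖S t (f + l • u)‖ ≤ M * K :=
      ((S t).le_of_opNorm_le (hM t ht.1 ht.2.le) _).trans (mul_le_mul_of_nonneg_left hK hM0)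
    calc rexp (l * t) * ‖S t (f + l • u)‖ ≤ rexp (l * t) * (M * K) :=
          mul_le_mul_of_nonneg_left h2 (exp_pos _).le
      _ = M * K / l * (l * rexp (l * t)) := by field_simp

end Semigroup

/-! ### Interior supported functions and high frequency quasimodes. -/

section Quasimode

theorem isLocH1_of_hasDerivAt {U U' : ℝ → ℝ} (hU : ∀ x, 0 < x → HasDerivAt U (U' x) x)
    (hU' : ContinuousOn U' (Ioi 0)) : IsLocH1 U U' := by
  refine ⟨fun ε h0 h1 => ?_, fun x hx => ?_⟩
  · have hc : ContinuousOn U' (Icc ε 1) := hU'.mono fun y hy => h0.trans_le hy.1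
    obtain ⟨C, hC⟩ := isCompact_Icc.exists_bound_of_continuousOn hc
    refine MemLp.of_bound ((hc.mono Ioo_subset_Icc_self).aestronglyMeasurable measurableSet_Ioo)
      C ?_
    filter_upwards [ae_restrict_mem measurableSet_Ioo] with y hy
    exact hC y (Ioo_subset_Icc_self hy)
  · have hsub : uIcc x 1 ⊆ Ioi 0 := by
      rw [uIcc_of_le hx.2]
      exact fun y hy => hx.1.trans_le hy.1
    rw [intervalIntegral.integral_eq_sub_of_hasDerivAt (fun y hy => hU y (hsub hy))
      ((hU'.mono hsub).intervalIntegrable)]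
    ring

/-- The functions that are continuous on `(0,∞)` and vanish outside `[1/4, 3/4]`. -/
structure IsInteriorSupported (g : ℝ → ℝ) : Prop where
  continuousOn : ContinuousOn g (Ioi 0)
  eq_zero : ∀ x, x ∉ Icc (1 / 4 : ℝ) (3 / 4) → g x = 0

namespace IsInteriorSupported

variable {g : ℝ → ℝ}

theorem mul_left (hg : IsInteriorSupported g) {w : ℝ → ℝ} (hw : ContinuousOn w (Ioi 0)) :
    IsInteriorSupported fun x => w x * g x :=
  ⟨hw.mul hg.continuousOn, fun x hx => by simp [hg.eq_zero x hx]⟩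

theorem add {g₂ : ℝ → ℝ} (hg : IsInteriorSupported g) (h₂ : IsInteriorSupported g₂) :
    IsInteriorSupported fun x => g x + g₂ x :=
  ⟨hg.continuousOn.add h₂.continuousOn, fun x hx => by simp [hg.eq_zero x hx, h₂.eq_zero x hx]⟩

theorem eventuallyEq_zero (hg : IsInteriorSupported g) : ∀ᶠ x in 𝓝 0, g x = 0 := by
  filter_upwards [Iio_mem_nhds (show (0 : ℝ) < 1 / 4 by norm_num)] with x hx
  exact hg.eq_zero x fun h => absurd h.1 (not_le.mpr hx)

theorem continuous (hg : IsInteriorSupported g) : Continuous g := by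
  refine continuous_iff_continuousAt.mpr fun x => ?_
  rcases lt_or_ge 0 x with hx | hx
  · exact hg.continuousOn.continuousAt (Ioi_mem_nhds hx)
  · refine (continuousAt_const (y := (0 : ℝ))).congr ?_
    filter_upwards [Iio_mem_nhds (show x < 1 / 4 by linarith)] with y hy
    exact (hg.eq_zero y fun h => absurd h.1 (not_le.mpr hy)).symm

theorem hasCompactSupport (hg : IsInteriorSupported g) : HasCompactSupport g :=
  HasCompactSupport.intro isCompact_Icc hg.eq_zero

theorem memLp (hg : IsInteriorSupported g) (p : ENNReal) : MemLp g p vol01 :=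
  (hg.continuous.memLp_of_hasCompactSupport hg.hasCompactSupport).restrict _

theorem exists_bound (hg : IsInteriorSupported g) : ∃ C, 0 ≤ C ∧ ∀ x, |g x| ≤ C := by
  obtain ⟨C, hC⟩ := hg.hasCompactSupport.exists_bound_of_continuous hg.continuous
  exact ⟨C, (norm_nonneg _).trans (hC 0), hC⟩

end IsInteriorSupported

theorem continuousOn_rpow_Ioi (r : ℝ) : ContinuousOn (fun x : ℝ => x ^ r) (Ioi 0) :=
  fun x hx => (continuousAt_rpow_const x r (Or.inl (ne_of_gt hx))).continuousWithinAt

theorem continuousOn_div_rpow_Ioi (c r : ℝ) : ContinuousOn (fun x : ℝ => c / x ^ r) (Ioi 0) :=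
  continuousOn_const.div (continuousOn_rpow_Ioi r) fun _ hx => (rpow_pos_of_pos hx r).ne'

/-- Interior supported functions that are regular enough belong to the domain of the operator. -/
theorem opGraph_of_isInteriorSupported (α β μ : ℝ) {U U' U'' Q : ℝ → ℝ}
    (hU : IsInteriorSupported U) (hU' : IsInteriorSupported U')
    (hU'' : ContinuousOn U'' (Ioi 0)) (hQ : ContinuousOn Q (Ioi 0))
    (h1 : ∀ x, 0 < x → HasDerivAt U (U' x) x) (h2 : ∀ x, 0 < x → HasDerivAt U' (U'' x) x)
    (h3 : ∀ x, 0 < x → HasDerivAt (fun x => x ^ α * U' x) (Q x) x)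
    {u f : L2} (hu : u =ᵐ[vol01] U) (hf : f =ᵐ[vol01] fun x => Q x + μ / x ^ β * U x) :
    OpGraph α β μ u f := by
  refine ⟨U, U', U'', Q, hu, isLocH1_of_hasDerivAt h1 hU'.continuousOn,
    isLocH1_of_hasDerivAt h2 hU'', isLocH1_of_hasDerivAt h3 hQ, ⟨fun _ => ?_, fun _ => ?_⟩,
    ⟨hU.eq_zero 1 (by norm_num), fun _ => ?_, fun _ => ?_⟩, hf⟩
  · exact (hU'.mul_left (continuousOn_rpow_Ioi _)).memLp 2
  · have e1 := (hU'.mul_left hU'.continuousOn).mul_left (continuousOn_rpow_Ioi α)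
    have e2 := (hU.mul_left hU.continuousOn).mul_left
      (continuousOn_div_rpow_Ioi (muCrit α) (2 - α))
    have := (memLp_one_iff_integrable.mp (e1.memLp 1)).sub
      (memLp_one_iff_integrable.mp (e2.memLp 1))
    simp only [pow_two]
    exact this
  · refine (tendsto_const_nhds (x := (0 : ℝ))).congr' ?_
    filter_upwards [nhdsWithin_le_nhds hU.eventuallyEq_zero] with x hx
    exact hx.symm
  · refine (tendsto_const_nhds (x := (0 : ℝ))).congr' ?_
    filter_upwards [nhdsWithin_le_nhds hU'.eventuallyEq_zero] with x hx
    simp [hx]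

theorem exists_interior_bump : ∃ φ φ₁ φ₂ : ℝ → ℝ,
    IsInteriorSupported φ ∧ IsInteriorSupported φ₁ ∧ IsInteriorSupported φ₂ ∧
    (∀ x, HasDerivAt φ (φ₁ x) x) ∧ (∀ x, HasDerivAt φ₁ (φ₂ x) x) ∧ 0 < ∫ x, φ x ^ 2 ∂vol01 := by
  let B : ContDiffBump (1 / 2 : ℝ) := ⟨1 / 8, 1 / 4, by norm_num, by norm_num⟩
  have hB : ContDiff ℝ 2 (B : ℝ → ℝ) := B.contDiff
  have hB1 : ContDiff ℝ 1 (deriv (B : ℝ → ℝ)) := hB.deriv'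
  have hts : tsupport (B : ℝ → ℝ) ⊆ Icc (1 / 4 : ℝ) (3 / 4) := by
    rw [B.tsupport_eq, Real.closedBall_eq_Icc]
    exact Icc_subset_Icc (by norm_num [B]) (by norm_num [B])
  have hts1 : tsupport (deriv (B : ℝ → ℝ)) ⊆ Icc (1 / 4 : ℝ) (3 / 4) :=
    (closure_minimal (support_deriv_subset) (isClosed_tsupport _)).trans hts
  have hz : ∀ g : ℝ → ℝ, tsupport g ⊆ Icc (1 / 4 : ℝ) (3 / 4) →
      ∀ x, x ∉ Icc (1 / 4 : ℝ) (3 / 4) → g x = 0 :=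
    fun g hg x hx => image_eq_zero_of_notMem_tsupport fun h => hx (hg h)
  have hs0 : IsInteriorSupported (B : ℝ → ℝ) := ⟨hB.continuous.continuousOn, hz _ hts⟩
  refine ⟨B, deriv B, deriv (deriv B), hs0, ⟨hB1.continuous.continuousOn, hz _ hts1⟩,
    ⟨(hB1.continuous_deriv le_rfl).continuousOn, hz _ ?_⟩,
    fun x => (hB.differentiable (by norm_num) x).hasDerivAt,
    fun x => (hB1.differentiable (by norm_num) x).hasDerivAt, ?_⟩
  · exact (closure_minimal (support_deriv_subset) (isClosed_tsupport _)).trans hts1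
  · have hint : Integrable (fun x => B x ^ 2) vol01 := (hs0.memLp 2).integrable_sq
    rw [integral_pos_iff_support_of_nonneg (fun x => sq_nonneg _) hint]
    have hsub : Ioo (3 / 8 : ℝ) (5 / 8) ⊆ Function.support fun x => B x ^ 2 := by
      intro x hx
      have : B x = 1 := B.one_of_mem_closedBall (by
        rw [Real.closedBall_eq_Icc]
        exact ⟨by norm_num [B]; linarith [hx.1], by norm_num [B]; linarith [hx.2]⟩)
      simp [this]
    refine lt_of_lt_of_le ?_ (measure_mono hsub)
    rw [Measure.restrict_apply measurableSet_Ioo, inter_eq_left.mpr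
      (Ioo_subset_Ioo (by norm_num) (by norm_num)), Real.volume_Ioo]
    norm_num

/-- High frequency approximate eigenvectors. The phase `θ` solves `x^α (θ')² = 1`. -/
theorem exists_quasimode (α β μ : ℝ) (hα : α < 2) : ∃ c C : ℝ, 0 < c ∧ 0 ≤ C ∧ ∀ n : ℕ,
    ∃ u f : L2, OpGraph α β μ u f ∧ c ≤ ‖u‖ ∧ ‖f + ((n : ℝ) ^ 2) • u‖ ≤ C * (1 + n) := by
  obtain ⟨φ, φ₁, φ₂, hφ, hφ₁, hφ₂, d0, d1, hpos⟩ := exists_interior_bump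
  set N := ∫ x, φ x ^ 2 ∂vol01 with hN
  have hr : (1 - α / 2) ≠ 0 := by linarith
  have hR := continuousOn_rpow_Ioi
  have hRd : ∀ r x : ℝ, 0 < x → HasDerivAt (fun x : ℝ => x ^ r) (r * x ^ (r - 1)) x :=
    fun r x hx => Real.hasDerivAt_rpow_const (Or.inl hx.ne')
  -- `E` and `F` are the amplitudes of orders `n⁰` and `n¹` in `A u + n² u`; the order `n²` cancels
  -- by the choice of phase.
  let E : ℝ → ℝ := fun x => (α * x ^ (α - 1) * φ₁ x + x ^ α * φ₂ x) + μ / x ^ β * φ x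
  let F : ℝ → ℝ := fun x => 2 * x ^ (α / 2) * φ₁ x + α / 2 * x ^ (α / 2 - 1) * φ x
  have hE : IsInteriorSupported E :=
    ((hφ₁.mul_left (continuousOn_const.mul (hR _))).add (hφ₂.mul_left (hR _))).add
      (hφ.mul_left (continuousOn_div_rpow_Ioi _ _))
  have hF : IsInteriorSupported F :=
    (hφ₁.mul_left (continuousOn_const.mul (hR _))).add
      (hφ.mul_left (continuousOn_const.mul (hR _)))
  obtain ⟨C₁, hC₁, hEb⟩ := hE.exists_bound
  obtain ⟨C₂, hC₂, hFb⟩ := hF.exists_bound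
  refine ⟨√(N / 2), max C₁ C₂, Real.sqrt_pos.mpr (by linarith), hC₁.trans (le_max_left _ _),
    fun n => ?_⟩
  -- `δ` is left free so that it can be chosen at the end to keep the norm away from zero.
  let P : ℝ → ℝ → ℝ := fun δ x => n * (x ^ (1 - α / 2) / (1 - α / 2)) + δ
  have hPc : ∀ δ, ContinuousOn (P δ) (Ioi 0) := fun δ =>
    (continuousOn_const.mul ((hR _).div_const _)).add continuousOn_const
  have hPd : ∀ δ x : ℝ, 0 < x → HasDerivAt (P δ) (n * x ^ (-(α / 2))) x := by
    intro δ x hx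
    refine ((((hRd (1 - α / 2) x hx).div_const (1 - α / 2)).const_mul (n : ℝ)).add_const
      δ).congr_deriv ?_
    rw [show (1 - α / 2 - 1 : ℝ) = -(α / 2) by ring, mul_div_right_comm,
      div_self hr, one_mul]
  have hsin : ∀ δ, ContinuousOn (fun x => sin (P δ x)) (Ioi 0) := fun δ =>
    Real.continuous_sin.comp_continuousOn (hPc δ)
  have hcos : ∀ δ, ContinuousOn (fun x => cos (P δ x)) (Ioi 0) := fun δ =>
    Real.continuous_cos.comp_continuousOn (hPc δ)
  let U : ℝ → ℝ → ℝ := fun δ x => sin (P δ x) * φ x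
  let U' : ℝ → ℝ → ℝ := fun δ x =>
    sin (P δ x) * φ₁ x + (n * x ^ (-(α / 2)) * cos (P δ x)) * φ x
  let U'' : ℝ → ℝ → ℝ := fun δ x =>
    (cos (P δ x) * (n * x ^ (-(α / 2))) * φ₁ x + sin (P δ x) * φ₂ x) +
      ((n * (-(α / 2) * x ^ (-(α / 2) - 1)) * cos (P δ x) +
        n * x ^ (-(α / 2)) * (-sin (P δ x) * (n * x ^ (-(α / 2))))) * φ x +
        n * x ^ (-(α / 2)) * cos (P δ x) * φ₁ x)
  let Q : ℝ → ℝ → ℝ := fun δ x => α * x ^ (α - 1) * U' δ x + x ^ α * U'' δ x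
  have hU : ∀ δ, IsInteriorSupported (U δ) := fun δ => hφ.mul_left (hsin δ)
  have hU' : ∀ δ, IsInteriorSupported (U' δ) := fun δ =>
    (hφ₁.mul_left (hsin δ)).add (hφ.mul_left ((continuousOn_const.mul (hR _)).mul (hcos δ)))
  have hU'' : ∀ δ, IsInteriorSupported (U'' δ) := fun δ =>
    ((hφ₁.mul_left ((hcos δ).mul (continuousOn_const.mul (hR _)))).add
      (hφ₂.mul_left (hsin δ))).add ((hφ.mul_left
        (((continuousOn_const.mul (continuousOn_const.mul (hR _))).mul (hcos δ)).add
        ((continuousOn_const.mul (hR _)).mul ((hsin δ).neg.mul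
          (continuousOn_const.mul (hR _)))))).add
        (hφ₁.mul_left ((continuousOn_const.mul (hR _)).mul (hcos δ))))
  have hQ : ∀ δ, IsInteriorSupported (Q δ) := fun δ =>
    ((hU' δ).mul_left (continuousOn_const.mul (hR _))).add ((hU'' δ).mul_left (hR _))
  have hd1 : ∀ δ x, 0 < x → HasDerivAt (U δ) (U' δ x) x := fun δ x hx => by
    refine ((hPd δ x hx).sin.mul (d0 x)).congr_deriv ?_
    simp only [U']
    ring
  have hd2 : ∀ δ x, 0 < x → HasDerivAt (U' δ) (U'' δ x) x := fun δ x hx =>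
    ((hPd δ x hx).sin.mul (d1 x)).add
      ((((hRd _ x hx).const_mul (n : ℝ)).mul (hPd δ x hx).cos).mul (d0 x))
  have hd3 : ∀ δ x, 0 < x → HasDerivAt (fun x => x ^ α * U' δ x) (Q δ x) x := fun δ x hx =>
    (hRd α x hx).mul (hd2 δ x hx)
  have hG : ∀ δ, IsInteriorSupported fun x => Q δ x + μ / x ^ β * U δ x := fun δ =>
    (hQ δ).add ((hU δ).mul_left (continuousOn_div_rpow_Ioi _ _))
  let u : ℝ → L2 := fun δ => ((hU δ).memLp 2).toLp _
  let f : ℝ → L2 := fun δ => ((hG δ).memLp 2).toLp _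
  have hu : ∀ δ, u δ =ᵐ[vol01] U δ := fun δ => MemLp.coeFn_toLp _
  have hf : ∀ δ, f δ =ᵐ[vol01] fun x => Q δ x + μ / x ^ β * U δ x := fun δ => MemLp.coeFn_toLp _
  have hop : ∀ δ, OpGraph α β μ (u δ) (f δ) := fun δ =>
    opGraph_of_isInteriorSupported α β μ (hU δ) (hU' δ) (hU'' δ).continuousOn
      (hQ δ).continuousOn (hd1 δ) (hd2 δ) (hd3 δ) (hu δ) (hf δ)
  have hid : ∀ δ x, 0 < x → Q δ x + μ / x ^ β * U δ x + (n : ℝ) ^ 2 * U δ x =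
      E x * sin (P δ x) + n * (F x * cos (P δ x)) := by
    intro δ x hx
    have e1 : x ^ α = x ^ (α / 2) * x ^ (α / 2) := by rw [← rpow_add hx]; congr 1; ring
    have e2 : x ^ (-(α / 2)) = (x ^ (α / 2))⁻¹ := rpow_neg hx.le _
    have e3 : x ^ (-(α / 2) - 1) = (x ^ (α / 2))⁻¹ * x⁻¹ := by
      rw [rpow_sub_one hx.ne', e2]; rfl
    have e4 : x ^ (α - 1) = x ^ (α / 2) * x ^ (α / 2) * x⁻¹ := by
      rw [rpow_sub_one hx.ne', e1]; rfl
    have e5 : x ^ (α / 2 - 1) = x ^ (α / 2) * x⁻¹ := by rw [rpow_sub_one hx.ne']; rfl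
    have hp : x ^ (α / 2) ≠ 0 := (rpow_pos_of_pos hx _).ne'
    simp only [Q, U'', U', U, E, F, e1, e2, e3, e4, e5]
    generalize x ^ (α / 2) = p at *
    generalize μ / x ^ β = m
    have hx' := hx.ne'
    field_simp
    ring
  have hbound : ∀ δ, ‖f δ + ((n : ℝ) ^ 2) • u δ‖ ≤ max C₁ C₂ * (1 + n) := by
    intro δ
    have hb := Lp.norm_le_of_ae_bound (f := f δ + ((n : ℝ) ^ 2) • u δ)
      (C := max C₁ C₂ * (1 + n)) (by positivity) ?_
    · simpa [measureUnivNNReal] using hb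
    · filter_upwards [hu δ, hf δ, Lp.coeFn_add (f δ) (((n : ℝ) ^ 2) • u δ),
        Lp.coeFn_smul ((n : ℝ) ^ 2) (u δ), ae_restrict_mem measurableSet_Ioo]
        with x h1 h2 h3 h4 h5
      rw [h3, Pi.add_apply, h4, Pi.smul_apply, h1, h2, smul_eq_mul, hid δ x h5.1,
        Real.norm_eq_abs]
      have hn : (0 : ℝ) ≤ n := Nat.cast_nonneg n
      have a1 : |E x * sin (P δ x)| ≤ max C₁ C₂ := by
        rw [abs_mul]
        exact (mul_le_of_le_one_right (abs_nonneg _) (abs_sin_le_one _)).trans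
          ((hEb x).trans (le_max_left _ _))
      have a2 : |F x * cos (P δ x)| ≤ max C₁ C₂ := by
        rw [abs_mul]
        exact (mul_le_of_le_one_right (abs_nonneg _) (abs_cos_le_one _)).trans
          ((hFb x).trans (le_max_right _ _))
      calc |E x * sin (P δ x) + n * (F x * cos (P δ x))|
          ≤ |E x * sin (P δ x)| + |n * (F x * cos (P δ x))| := abs_add_le _ _
        _ ≤ max C₁ C₂ + n * max C₁ C₂ := by
            rw [abs_mul (n : ℝ), abs_of_nonneg hn]
            exact add_le_add a1 (mul_le_mul_of_nonneg_left a2 hn)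
        _ = max C₁ C₂ * (1 + n) := by ring
  have hnorm : ∀ δ, ‖u δ‖ ^ 2 = ∫ x, U δ x ^ 2 ∂vol01 := by
    intro δ
    rw [← real_inner_self_eq_norm_sq, L2.inner_def]
    refine integral_congr_ae ?_
    filter_upwards [hu δ] with x hx
    simp [hx, pow_two]
  -- As `sin² + cos² = 1`, one of the two phases carries at least half of `N`; no oscillatory
  -- integral is estimated.
  have hsum : ‖u 0‖ ^ 2 + ‖u (π / 2)‖ ^ 2 = N := by
    rw [hnorm, hnorm, ← integral_add ((hU 0).memLp 2).integrable_sq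
      ((hU (π / 2)).memLp 2).integrable_sq, hN]
    congr 1
    ext x
    simp only [U, P, add_zero, sin_add_pi_div_two]
    have := sin_sq_add_cos_sq (n * (x ^ (1 - α / 2) / (1 - α / 2)))
    linear_combination φ x ^ 2 * this
  have hex : ∃ δ, N / 2 ≤ ‖u δ‖ ^ 2 := by
    by_contra! hc
    linarith [hc 0, hc (π / 2)]
  obtain ⟨δ, hδ⟩ := hex
  exact ⟨u δ, f δ, hop δ, Real.sqrt_le_iff.mpr ⟨norm_nonneg _, hδ⟩, hbound δ⟩

end Quasimode

/-- For `h > 0` the operator `e^{hA}` is not bounded from below. -/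
theorem IsSemigroupOf.exists_norm_apply_le {α β μ : ℝ} {S : ℝ → L2 →L[ℝ] L2}
    (hS : IsSemigroupOf α β μ S) (hα : α < 2) {h : ℝ} (hh : 0 < h) {ε : ℝ} (hε : 0 < ε) :
    ∃ u : L2, 0 < ‖u‖ ∧ ‖S h u‖ ≤ ε * ‖u‖ := by
  obtain ⟨c, C, hc, hC, hqm⟩ := exists_quasimode α β μ hα
  obtain ⟨M, hM0, hM⟩ := hS.1.exists_bound h
  have hinv : Tendsto (fun n : ℕ => ((n : ℝ))⁻¹) atTop (𝓝 0) :=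
    tendsto_inv_atTop_zero.comp tendsto_natCast_atTop_atTop
  have hlim : Tendsto (fun n : ℕ => rexp (-((n : ℝ) ^ 2 * h)) +
      M * C / c * (((n : ℝ)⁻¹) ^ 2 + (n : ℝ)⁻¹)) atTop (𝓝 0) := by
    have h1 : Tendsto (fun n : ℕ => rexp (-((n : ℝ) ^ 2 * h))) atTop (𝓝 0) := by
      refine tendsto_exp_neg_atTop_nhds_zero.comp (Tendsto.atTop_mul_const hh ?_)
      exact (tendsto_pow_atTop two_ne_zero).comp tendsto_natCast_atTop_atTop
    have h2 := h1.add (((hinv.pow 2).add hinv).const_mul (M * C / c))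
    simpa using h2
  obtain ⟨n, hn, hn0⟩ := ((hlim.eventually (gt_mem_nhds hε)).and (eventually_gt_atTop 0)).exists
  obtain ⟨u, f, hop, hcu, hfu⟩ := hqm n
  have hnpos : (0 : ℝ) < n := Nat.cast_pos.mpr hn0
  refine ⟨u, hc.trans_le hcu, ?_⟩
  have hmain := hS.1.norm_apply_le_of_quasimode ((hS.2 u f).mpr hop) hh.le
    (pow_pos hnpos 2) hM hfu
  have h1 : M * (C * (1 + n)) / (n : ℝ) ^ 2 ≤ M * C / c * (((n : ℝ)⁻¹) ^ 2 + (n : ℝ)⁻¹) * ‖u‖ := by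
    have : M * (C * (1 + n)) / (n : ℝ) ^ 2 = M * C / c * (((n : ℝ)⁻¹) ^ 2 + (n : ℝ)⁻¹) * c := by
      field_simp
    rw [this]
    exact mul_le_mul_of_nonneg_left hcu (by positivity)
  calc ‖S h u‖ ≤ _ := hmain
    _ ≤ (rexp (-((n : ℝ) ^ 2 * h)) + M * C / c * (((n : ℝ)⁻¹) ^ 2 + (n : ℝ)⁻¹)) * ‖u‖ := by
      rw [add_mul]
      linarith
    _ ≤ ε * ‖u‖ := mul_le_mul_of_nonneg_right hn.le (norm_nonneg _)

theorem tSeq_succ_sub_tauSeq_pos {T b : ℝ} (hT : 0 < T) (hb : 1 < b) (k : ℕ) :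
    0 < tSeq T b (k + 1) - tauSeq T b k := by
  have h1 : 1 / b ^ (k + 1) < 1 / b ^ k :=
    one_div_lt_one_div_of_lt (by positivity) (pow_lt_pow_right₀ hb (Nat.lt_succ_self k))
  have h2 := mul_lt_mul_of_pos_left h1 hT
  simp only [tauSeq, tSeq]
  linarith

end ImpulseControl

/-! ### Non-coercivity of the dual functional. -/

open ImpulseControl in
theorem mainTheorem4 (α β μ : ℝ)
    (hαβμ : ImpulseControl.SubCritical α β μ ∨ ImpulseControl.Critical α β μ)
    (S : ℝ → ImpulseControl.L2 →L[ℝ] ImpulseControl.L2)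
    (hS : ImpulseControl.IsSemigroupOf α β μ S)
    (a : ℝ) (ha0 : 0 < a) (ha1 : a < 1)
    (T b : ℝ) (hT : 0 < T) (hb : 1 < b)
    (y₀ : ImpulseControl.L2) (k : ℕ) :
    ¬ ImpulseControl.Coercive
      (ImpulseControl.dualFunctional S (Set.Ioo 0 a) T b y₀ k) := by
  intro hco
  have hα : α < 2 := by
    rcases hαβμ with (h | h) | h
    · exact h.2.1
    · exact h.2.1
    · exact h.2.1
  have hh := tSeq_succ_sub_tauSeq_pos hT hb k
  have h2h : tSeq T b (k + 1) - tSeq T b k = (tSeq T b (k + 1) - tauSeq T b k) +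
      (tSeq T b (k + 1) - tauSeq T b k) := by
    simp only [tauSeq]
    ring
  set h := tSeq T b (k + 1) - tauSeq T b k with hdef
  set R := restrictTo (Set.Ioo 0 a)
  -- This threshold bounds the functional at every `v` with `‖S h v‖ ≤ 1`.
  have hev := hco.eventually (eventually_gt_atTop (1 / 2 * ‖R‖ ^ 2 + ‖y₀‖ * ‖S h‖))
  rw [eventually_comap] at hev
  obtain ⟨r, hr⟩ := eventually_atTop.mp hev
  have hρ : 0 < max r 1 := lt_max_of_lt_right one_pos
  -- With `ε = 1 / max r 1`, rescaling `u` to norm `max r 1` gives `‖S h v‖ ≤ 1`.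
  obtain ⟨u, hu, hSu⟩ := hS.exists_norm_apply_le hα hh (inv_pos.mpr hρ)
  have hv := hr (max r 1) (le_max_left _ _) ((max r 1 / ‖u‖) • u) (by
    rw [norm_smul, Real.norm_of_nonneg (by positivity)]
    field_simp)
  generalize (max r 1 / ‖u‖) • u = v, hvdef : (max r 1 / ‖u‖) • u = v at hv
  have hSv : ‖S h v‖ ≤ 1 := by
    rw [← hvdef, map_smul, norm_smul, Real.norm_of_nonneg (by positivity)]
    calc max r 1 / ‖u‖ * ‖S h u‖ ≤ max r 1 / ‖u‖ * ((max r 1)⁻¹ * ‖u‖) :=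
          mul_le_mul_of_nonneg_left hSu (by positivity)
      _ = 1 := by field_simp
  have h1 : ‖R (S h v)‖ ≤ ‖R‖ := R.le_of_opNorm_le_of_le le_rfl hSv |>.trans (by simp)
  have h2 : ‖S h (S h v)‖ ≤ ‖S h‖ := (S h).le_of_opNorm_le_of_le le_rfl hSv |>.trans (by simp)
  have h3 : inner ℝ y₀ (S h (S h v)) ≤ ‖y₀‖ * ‖S h‖ :=
    (real_inner_le_norm _ _).trans (mul_le_mul_of_nonneg_left h2 (norm_nonneg _))
  have h4 : ‖R (S h v)‖ ^ 2 ≤ ‖R‖ ^ 2 := pow_le_pow_left₀ (norm_nonneg _) h1 2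
  simp only [dualFunctional] at hv
  rw [h2h, hS.1.add_apply hh.le hh.le] at hv
  linarith
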